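/- **Replacement Lemma.** Fix $\beta\in[0,\infty)$, points $b_1,\dots,b_k$ of the torus $\mathbb T=\mathbb R/\mathbb Z$ and $t\ge 0$. For $N\ge1$ let $\mathbb T_N=\mathbb Z/N\mathbb Z$, where $x\in\mathbb T_N$ corresponds to $x/N\in\mathbb T$. We say that the bond $\{x,x+1\}$ contains $u\in\mathbb T$, and that $x$ and $x+1$ are its left and right vertices, if $u\in(\frac xN,\frac{x+1}N]$. A bond is called slow if it contains some $b_i$; put $\xi^N_{x,x+1}=N^{-\beta}$ if $\{x,x+1\}$ is slow and $\xi^N_{x,x+1}=1$ otherwise. For each $N\geq 1$ let $\mu_N$ be any probability measure on $\{0,1\}^{\mathbb T_N}$, and let $\mathbb E^\beta_{\mu_N}$ be the expectation with respect to the law of the càdlàg Markov process $(\eta_s)_{s\ge0}$ on $\{0,1\}^{\mathbb T_N}$ with initial distribution $\mu_N$ and generator $N^2\mathcal L_N$, where $$\mathcal L_Nf(\eta)=\sum_{x\in\mathbb T_N}\xi^N_{x,x+1}\,[f(\eta^{x,x+1})-f(\eta)]$$ and $\eta^{x,x+1}$ is $\eta$ with the values at $x$ and $x+1$ exchanged.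 For $\varepsilon>0$ write $\ell=\lfloor\varepsilon N\rfloor$. If $\beta<1$, let $\eta^{\varepsilon N}(x)=\frac1\ell\sum_{y=x+1}^{x+\ell}\eta(y)$. If $\beta\ge1$, use the same formula when no left vertex of a slow bond lies in $\{x,\dots,x+\ell\}$, and otherwise let $\eta^{\varepsilon N}(x)=\frac1\ell\sum_{y=z-\ell+1}^{z}\eta(y)$, where $z\in\{x,\dots,x+\ell\}$ is the left vertex of a slow bond (the first one met from $x$; for $\varepsilon$ small and $N$ large there is only one). 1. Let $\beta\in[0,1)$ and $u\in\mathbb T$. If, for every $N$, $x=x_N\in\mathbb T_N$ is the left or the right vertex of the bond containing $u$, then $$\varlimsup_{\varepsilon\downarrow0}\varlimsup_{N\to\infty}\mathbb E^\beta_{\mu_N}\Big[\Big|\int_0^t\{\eta_s(x)-\eta_s^{\varepsilon N}(x)\}\,ds\Big|\Big]=0.$$ 2. Let $\beta\in[1,\infty)$. The same limit holds for every choice of sites $x=x_N\in\mathbb T_N$. Moreover, for every $H:\mathbb T\to\mathbb R$ with $\varlimsup_{N\to\infty}\frac1N\sum_{x\in\mathbb T_N}H(\frac xN)^2<\infty$,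 $$\varlimsup_{\varepsilon\downarrow0}\varlimsup_{N\to\infty}\mathbb E^\beta_{\mu_N}\Big[\Big|\int_0^t\frac1N\sum_{x\in\mathbb T_N}H(\tfrac xN)\{\eta_s(x)-\eta_s^{\varepsilon N}(x)\}\,ds\Big|\Big]=0.$$ -/

import Mathlib

open Filter Topology MeasureTheory
open scoped NNReal ENNReal

noncomputable section

namespace SlowBond

/-- Configurations `η ∈ {0,1}^{𝕋_N}`; the discrete torus `𝕋_N` with `N` sites is `ZMod N`. -/
abbrev Config (N : ℕ) : Type := ZMod N → Fin 2

/-- The occupation number `η(x)` as a real number. -/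
def occ {N : ℕ} (η : Config N) (x : ZMod N) : ℝ := ((η x : ℕ) : ℝ)

/-- The macroscopic point `x / N` of the continuous torus `𝕋 = ℝ / ℤ`. -/
def macro_point (N : ℕ) (x : ZMod N) : UnitAddCircle := (((x.val : ℝ) / N : ℝ) : UnitAddCircle)

/-- `x` is the left vertex of the bond `{x, x+1}` that contains the macroscopic point `u`,
i.e. `u` lies on the arc `(x/N, (x+1)/N]` of the torus. -/
def IsLeftVertex (N : ℕ) (u : UnitAddCircle) (x : ZMod N) : Prop :=
  ∃ v ∈ Set.Ioc ((x.val : ℝ) / N) (((x.val : ℝ) + 1) / N), (v : UnitAddCircle) = u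

/-- The bond `{x, x+1}` is slow: it contains one of the points `b_1, …, b_k`. -/
def IsSlowBond (N : ℕ) {k : ℕ} (b : Fin k → UnitAddCircle) (x : ZMod N) : Prop :=
  ∃ i, IsLeftVertex N (b i) x

open Classical in
/-- The conductance `ξ^N_{x,x+1}`: `N^{-β}` at slow bonds and `1` at all other bonds. -/
def conductance (N : ℕ) {k : ℕ} (b : Fin k → UnitAddCircle) (β : ℝ) (x : ZMod N) : ℝ :=
  if IsSlowBond N b x then (N : ℝ) ^ (-β) else 1

/-- The configuration `η^{x,x+1}`, with the occupations of `x` and `x + 1` exchanged. -/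
def exchange {N : ℕ} (η : Config N) (x : ZMod N) : Config N :=
  fun y => η (Equiv.swap x (x + 1) y)

/-- The generator
`(L_N f)(η) = ∑_{x ∈ 𝕋_N} ξ^N_{x,x+1} [f(η^{x,x+1}) - f(η)]` of the exclusion process. -/
def generator (N : ℕ) [NeZero N] {k : ℕ} (b : Fin k → UnitAddCircle) (β : ℝ)
    (f : Config N → ℝ) (η : Config N) : ℝ :=
  ∑ x : ZMod N, conductance N b β x * (f (exchange η x) - f η)

/-- The matrix of `L_N`: its `(η, ζ)` entry is `L_N 1_{ζ} (η)`. -/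
def rateMatrix (N : ℕ) [NeZero N] {k : ℕ} (b : Fin k → UnitAddCircle) (β : ℝ) :
    Matrix (Config N) (Config N) ℝ :=
  Matrix.of fun η ζ => generator N b β (Pi.single ζ 1) η

/-- The transition matrix `exp (t N² L_N)` of the exclusion process speeded up by `N²`. -/
def transition (N : ℕ) [NeZero N] {k : ℕ} (b : Fin k → UnitAddCircle) (β : ℝ) (t : ℝ) :
    Matrix (Config N) (Config N) ℝ :=
  NormedSpace.exp ((t * (N : ℝ) ^ 2) • rateMatrix N b β)

/-- The space `D(ℝ₊, {0,1}^{𝕋_N})` of càdlàg trajectories. As a subtype of a product it carries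
the σ-algebra generated by the evaluation maps. -/
abbrev PathSpace (N : ℕ) : Type :=
  {ω : ℝ≥0 → Config N //
    ∀ t, ContinuousWithinAt ω (Set.Ici t) t ∧ ∃ l, Tendsto ω (𝓝[<] t) (𝓝 l)}

/-- `P` is the law on `D(ℝ₊, {0,1}^{𝕋_N})` of the Markov process with generator `N² L_N` and
initial distribution `μ`, characterised by its finite-dimensional distributions. -/
structure IsExclusionLaw (N : ℕ) [NeZero N] {k : ℕ} (b : Fin k → UnitAddCircle) (β : ℝ)
    (μ : Measure (Config N)) (P : Measure (PathSpace N)) : Prop where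
  isProbabilityMeasure : IsProbabilityMeasure P
  fdd : ∀ (n : ℕ) (t : ℕ → ℝ≥0), t 0 = 0 → Monotone t → ∀ a : ℕ → Config N,
    P {ω | ∀ i ≤ n, ω.1 (t i) = a i} =
      μ {a 0} * ENNReal.ofReal (∏ i ∈ Finset.range n,
        transition N b β ((t (i + 1) : ℝ) - t i) (a i) (a (i + 1)))

/-- The mean occupation of the `ℓ` sites `x + 1, …, x + ℓ`. -/
def boxMean {N : ℕ} (ℓ : ℕ) (η : Config N) (x : ZMod N) : ℝ :=
  (1 / (ℓ : ℝ)) * ∑ j ∈ Finset.Icc 1 ℓ, occ η (x + (j : ZMod N))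

open Classical in
/-- The empirical density `η^ℓ(x)`. For `β < 1` it is the mean over `x + 1, …, x + ℓ`.
For `β ≥ 1` the same box is used if no left vertex of a slow bond lies in `{x, …, x + ℓ}`;
otherwise, if `z` is the left vertex of a slow bond in `{x, …, x + ℓ}`, the box is
`z - ℓ + 1, …, z`. (If there are several such `z`, the first one to the right of `x` is used;
for `ℓ = ⌊ε N⌋`, `ε` small and `N` large, `z` is unique.) -/
def empiricalDensity {N : ℕ} {k : ℕ} (b : Fin k → UnitAddCircle) (β : ℝ) (ℓ : ℕ)
    (η : Config N) (x : ZMod N) : ℝ :=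
  if β < 1 then boxMean ℓ η x
  else if ∃ j : ℕ, j ≤ ℓ ∧ IsSlowBond N b (x + (j : ZMod N)) then
    boxMean ℓ η
      (x + ((sInf {j : ℕ | IsSlowBond N b (x + (j : ZMod N))} : ℕ) : ZMod N) - (ℓ : ZMod N))
  else boxMean ℓ η x

/-- `η_s(x) - η_s^{εN}(x)` along the trajectory `ω`, where `εN` stands for `⌊ε N⌋`. -/
def discrepancy {N : ℕ} {k : ℕ} (b : Fin k → UnitAddCircle) (β ε : ℝ) (ω : PathSpace N)
    (s : ℝ) (x : ZMod N) : ℝ :=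
  occ (ω.1 s.toNNReal) x - empiricalDensity b β ⌊ε * (N : ℝ)⌋₊ (ω.1 s.toNNReal) x

end SlowBond

end

/-! The discrepancy at a site is a linear functional `V η = ∑ y, v y * occ η y`, with `v` a point
mass minus the uniform mass on a box, and linear functionals of exclusion are governed by a single
random walk: the generator maps them to linear functionals through `walkMatrix`. Hence
E[V(η_s)V(η_r)] = E[V(η_s) ∑ (S_{r-s} v)(y) η_s(y)] for s ≤ r, where S is the walk semigroup speeded
up by N². Integrating over r ∈ [s,t] puts the walk integral G = ∫₀^{t-s} S_u v du in place of
S_{r-s} v. Since |V| ≤ 1 and occupations lie in [0,1], the result is at most the ℓ¹ norm of G, for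
any law of η_s; neither an invariant measure nor an entropy bound is needed.

The norm of G is controlled by an effective resistance R, a constant with ⟨v,g⟩² ≤ R D(g) for all g,
D being the Dirichlet form. An energy argument gives ‖G_τ‖₂² ≤ Rτ/(2N²) (`sum_sq_walkIntegral_le`),
and Cauchy–Schwarz over the N sites gives ‖G_τ‖₁² ≤ Rτ/(2N). The second moment of the time integral
is therefore at most 2t√(Rt/(2N)) (`IsExclusionLaw.lintegral_abs_integral_le`).

It remains to see R ≤ 2εN. The resistance of a path through the box and the site serves as R. For β
< 1 it is at most εN + kN^β; for β ≥ 1 the box is chosen so that the path crosses no slow bond, and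
it equals ⌊εN⌋. The estimate is uniform in the site, so averages weighted by H follow from |H| ≤ 1 +
H². -/

noncomputable section

namespace SlowBond

/-! ### Exponentials of matrices -/

section MatrixExp

open scoped Matrix

lemma hasSum_exp_matrix {m : Type*} [Fintype m] [DecidableEq m] (X : Matrix m m ℝ) :
    HasSum (fun n : ℕ => (n.factorial : ℝ)⁻¹ • X ^ n) (NormedSpace.exp X) := by
  open scoped Matrix.Norms.Operator in
  exact NormedSpace.exp_series_hasSum_exp' X

lemma hasDerivAt_exp_smul_matrix {m : Type*} [Fintype m] [DecidableEq m] (X : Matrix m m ℝ)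
    (i j : m) (u : ℝ) :
    HasDerivAt (fun u : ℝ => NormedSpace.exp (u • X) i j) ((X * NormedSpace.exp (u • X)) i j) u := by
  open scoped Matrix.Norms.Operator in
  have h := hasDerivAt_exp_smul_const' (𝕂 := ℝ) X u
  have h2 := (Matrix.entryLinearMap ℝ ℝ i j).toContinuousLinearMap.hasFDerivAt.comp_hasDerivAt u h
  exact h2

/-- The relation passes to all powers, hence to the exponential series. `M` is rectangular because
it links configurations to sites. -/
lemma exp_mul_of_intertwine {m n : Type*} [Fintype m] [DecidableEq m] [Fintype n] [DecidableEq n]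
    {X : Matrix m m ℝ} {Y : Matrix n n ℝ} {M : Matrix m n ℝ} (h : X * M = M * Y) :
    NormedSpace.exp X * M = M * NormedSpace.exp Y := by
  have hpow : ∀ k : ℕ, X ^ k * M = M * Y ^ k := by
    intro k
    induction k with
    | zero => simp
    | succ k ih => rw [pow_succ, Matrix.mul_assoc, h, ← Matrix.mul_assoc, ih, Matrix.mul_assoc,
        ← pow_succ]
  have hX : HasSum (fun k : ℕ => (k.factorial : ℝ)⁻¹ • (X ^ k * M)) (NormedSpace.exp X * M) := by
    have := (hasSum_exp_matrix X).map (AddMonoidHom.mk' (fun Z : Matrix m m ℝ => Z * M)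
      (fun a b => Matrix.add_mul a b M)) (by
        change Continuous fun Z : Matrix m m ℝ => Z * M
        fun_prop)
    refine this.congr_fun ?_
    intro k
    simp
  have hY : HasSum (fun k : ℕ => (k.factorial : ℝ)⁻¹ • (M * Y ^ k)) (M * NormedSpace.exp Y) := by
    have := (hasSum_exp_matrix Y).map (AddMonoidHom.mk' (fun Z : Matrix n n ℝ => M * Z)
      (fun a b => Matrix.mul_add M a b)) (by
        change Continuous fun Z : Matrix n n ℝ => M * Z
        fun_prop)
    refine this.congr_fun ?_
    intro k
    simp
  simp only [hpow] at hX
  exact hX.unique hY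

lemma exp_nonneg_of_nonneg {m : Type*} [Fintype m] [DecidableEq m] {X : Matrix m m ℝ}
    (hX : ∀ i j, 0 ≤ X i j) (i j : m) : 0 ≤ NormedSpace.exp X i j := by
  have hpow : ∀ k : ℕ, ∀ i j, 0 ≤ (X ^ k) i j := by
    intro k
    induction k with
    | zero => intro i j; rw [pow_zero, Matrix.one_apply]; split_ifs <;> norm_num
    | succ k ih =>
      intro i j
      rw [pow_succ, Matrix.mul_apply]
      exact Finset.sum_nonneg fun l _ => mul_nonneg (ih i l) (hX l j)
  have h := Pi.hasSum.1 (Pi.hasSum.1 (hasSum_exp_matrix X) i) j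
  refine h.nonneg fun k => ?_
  exact mul_nonneg (by positivity) (hpow k i j)

/-- Adding a large multiple of the identity makes all entries nonnegative and only rescales the
exponential. Applied to transition matrices, it ensures that `ENNReal.ofReal` in `fdd` truncates
nothing. -/
lemma exp_nonneg_of_offDiag_nonneg {m : Type*} [Fintype m] [DecidableEq m] {X : Matrix m m ℝ}
    (hX : ∀ i j, i ≠ j → 0 ≤ X i j) (i j : m) : 0 ≤ NormedSpace.exp X i j := by
  set c : ℝ := ∑ i, |X i i| with hc
  have hB : ∀ i j, 0 ≤ (X + Matrix.diagonal fun _ => c : Matrix m m ℝ) i j := by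
    intro i j
    rw [Matrix.add_apply]
    by_cases h : i = j
    · subst h
      rw [Matrix.diagonal_apply_eq]
      have := Finset.single_le_sum (f := fun i => |X i i|) (fun i _ => abs_nonneg _)
        (Finset.mem_univ i)
      have h2 := neg_abs_le (X i i)
      beta_reduce at this
      linarith
    · rw [Matrix.diagonal_apply_ne _ h, add_zero]
      exact hX i j h
  have hcomm : Commute (Matrix.diagonal fun _ : m => -c) (X + Matrix.diagonal fun _ => c) := by
    have : (Matrix.diagonal fun _ : m => -c) = algebraMap ℝ (Matrix m m ℝ) (-c) := rfl
    rw [this]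
    exact Algebra.commute_algebraMap_left _ _
  have hsum : X = (Matrix.diagonal fun _ : m => -c) + (X + Matrix.diagonal fun _ => c) := by
    ext i j
    by_cases h : i = j
    · subst h; simp
    · simp [Matrix.diagonal_apply_ne _ h]
  rw [hsum, Matrix.exp_add_of_commute _ _ hcomm, Matrix.exp_diagonal, Matrix.diagonal_mul]
  refine mul_nonneg ?_ (exp_nonneg_of_nonneg hB i j)
  rw [Pi.coe_exp, ← Real.exp_eq_exp_ℝ]
  exact (Real.exp_pos _).le

end MatrixExp

/-! ### The generator and its dual random walk -/

section Dual

open scoped Matrix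

variable (N : ℕ) [NeZero N] {k : ℕ} (b : Fin k → UnitAddCircle) (β : ℝ)

lemma conductance_pos (x : ZMod N) : 0 < conductance N b β x := by
  have : (0 : ℝ) < N := by exact_mod_cast NeZero.pos N
  unfold conductance
  split_ifs
  · positivity
  · norm_num

/-- The generator of the random walk on `ZMod N` with the conductances of the exclusion process,
which is dual to the exclusion process. -/
def walkMatrix : Matrix (ZMod N) (ZMod N) ℝ :=
  Matrix.of fun y z => ∑ x : ZMod N, conductance N b β x *
    ((Pi.single z 1 : ZMod N → ℝ) (Equiv.swap x (x + 1) y) - (Pi.single z 1 : ZMod N → ℝ) y)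

lemma walkMatrix_mulVec (f : ZMod N → ℝ) (y : ZMod N) :
    (walkMatrix N b β *ᵥ f) y =
      ∑ x : ZMod N, conductance N b β x * (f (Equiv.swap x (x + 1) y) - f y) := by
  simp only [Matrix.mulVec, dotProduct, walkMatrix, Matrix.of_apply, Finset.sum_mul]
  rw [Finset.sum_comm]
  refine Finset.sum_congr rfl fun x _ => ?_
  simp only [mul_assoc, sub_mul, ← Finset.mul_sum, Finset.sum_sub_distrib, Pi.single_apply,
    ite_mul, one_mul, zero_mul, Finset.sum_ite_eq, Finset.mem_univ, if_true]

lemma rateMatrix_mulVec (f : Config N → ℝ) (η : Config N) :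
    (rateMatrix N b β *ᵥ f) η = generator N b β f η := by
  simp only [Matrix.mulVec, dotProduct, rateMatrix, generator, Matrix.of_apply, Finset.sum_mul]
  rw [Finset.sum_comm]
  refine Finset.sum_congr rfl fun x _ => ?_
  simp only [mul_assoc, sub_mul, ← Finset.mul_sum, Finset.sum_sub_distrib, Pi.single_apply,
    ite_mul, one_mul, zero_mul, Finset.sum_ite_eq, Finset.mem_univ, if_true]

/-- The matrix of occupation numbers. -/
def occMatrix (N : ℕ) : Matrix (Config N) (ZMod N) ℝ := Matrix.of fun η y => occ η y

/-- Exchanging the contents of a bond and reading site `z` is reading the swapped site in the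
original configuration, so the exclusion rule leaves no trace on linear functionals. -/
lemma rateMatrix_mul_occMatrix :
    rateMatrix N b β * occMatrix N = occMatrix N * walkMatrix N b β := by
  ext η z
  have h1 : (rateMatrix N b β * occMatrix N) η z = generator N b β (fun η => occ η z) η := by
    rw [← rateMatrix_mulVec]; rfl
  rw [h1, Matrix.mul_apply]
  simp only [generator, occMatrix, walkMatrix, Matrix.of_apply, Finset.mul_sum]
  rw [Finset.sum_comm]
  refine Finset.sum_congr rfl fun x _ => ?_
  have h2 : ∀ y, (Pi.single z 1 : ZMod N → ℝ) (Equiv.swap x (x + 1) y) =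
      (Pi.single (Equiv.swap x (x + 1) z) 1 : ZMod N → ℝ) y := by
    intro y
    simp only [Pi.single_apply]
    congr 1
    rw [eq_iff_iff]
    constructor
    · rintro rfl; simp
    · rintro rfl; simp
  have h3 : ∀ y, occ η y * (conductance N b β x *
      ((Pi.single z 1 : ZMod N → ℝ) (Equiv.swap x (x + 1) y) - (Pi.single z 1 : ZMod N → ℝ) y)) =
      conductance N b β x * (occ η y * (Pi.single (Equiv.swap x (x + 1) z) 1 : ZMod N → ℝ) y
        - occ η y * (Pi.single z 1 : ZMod N → ℝ) y) := fun y => by rw [h2]; ring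
  rw [Finset.sum_congr rfl fun y _ => h3 y]
  simp only [← Finset.mul_sum, Finset.sum_sub_distrib, Pi.single_apply, mul_ite, mul_one,
    mul_zero, Finset.sum_ite_eq', Finset.mem_univ, if_true]
  rfl

/-- The semigroup of the dual random walk, speeded up by `N²`. -/
def walkSemigroup (u : ℝ) : Matrix (ZMod N) (ZMod N) ℝ :=
  NormedSpace.exp (u • ((N : ℝ) ^ 2 • walkMatrix N b β))

/-- Duality between the exclusion process and the random walk. -/
lemma transition_mulVec_linear (u : ℝ) (v : ZMod N → ℝ) (η : Config N) :
    ∑ ζ, transition N b β u η ζ * ∑ y, v y * occ ζ y =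
      ∑ y, (walkSemigroup N b β u *ᵥ v) y * occ η y := by
  have h : transition N b β u * occMatrix N = occMatrix N * walkSemigroup N b β u := by
    unfold transition walkSemigroup
    refine exp_mul_of_intertwine ?_
    rw [smul_smul, Matrix.smul_mul, Matrix.mul_smul, rateMatrix_mul_occMatrix]
  have h2 : transition N b β u *ᵥ (occMatrix N *ᵥ v) =
      occMatrix N *ᵥ (walkSemigroup N b β u *ᵥ v) := by
    rw [Matrix.mulVec_mulVec, h, Matrix.mulVec_mulVec]
  have h3 := congrFun h2 η
  simp only [Matrix.mulVec, dotProduct, occMatrix, Matrix.of_apply] at h3 ⊢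
  simp only [mul_comm (occ _ _)] at h3
  exact h3

lemma transition_nonneg {u : ℝ} (hu : 0 ≤ u) (η ζ : Config N) : 0 ≤ transition N b β u η ζ := by
  unfold transition
  refine exp_nonneg_of_offDiag_nonneg ?_ η ζ
  intro η ζ h
  rw [Matrix.smul_apply, smul_eq_mul]
  refine mul_nonneg (by positivity) ?_
  simp only [rateMatrix, generator, Matrix.of_apply]
  refine Finset.sum_nonneg fun x _ => mul_nonneg ((conductance_pos N b β x).le) ?_
  rw [Pi.single_eq_of_ne h, sub_zero, Pi.single_apply]
  split_ifs <;> norm_num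

/-! ### The Dirichlet form and the time integral of the semigroup -/

/-- The Dirichlet form of the random walk. -/
def dirichlet (g : ZMod N → ℝ) : ℝ :=
  ∑ x : ZMod N, conductance N b β x * (g (x + 1) - g x) ^ 2

lemma dirichlet_nonneg (g : ZMod N → ℝ) : 0 ≤ dirichlet N b β g :=
  Finset.sum_nonneg fun x _ => mul_nonneg ((conductance_pos N b β x).le) (sq_nonneg _)

lemma sum_mul_swap_sub {ι : Type*} [Fintype ι] [DecidableEq ι] (g : ι → ℝ) (x z : ι) :
    ∑ y, g y * (g (Equiv.swap x z y) - g y) = -(g z - g x) ^ 2 := by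
  by_cases h : x = z
  · subst h; simp
  · rw [Finset.sum_eq_add x z h]
    · simp only [Equiv.swap_apply_left, Equiv.swap_apply_right]; ring
    · rintro y - ⟨h1, h2⟩
      rw [Equiv.swap_apply_of_ne_of_ne h1 h2]; ring
    · simp
    · simp

lemma sum_mul_walkMatrix_mulVec (g : ZMod N → ℝ) :
    ∑ y, g y * (walkMatrix N b β *ᵥ g) y = -dirichlet N b β g := by
  simp only [walkMatrix_mulVec, Finset.mul_sum]
  rw [Finset.sum_comm, dirichlet, ← Finset.sum_neg_distrib]
  refine Finset.sum_congr rfl fun x _ => ?_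
  rw [← mul_neg, ← sum_mul_swap_sub, Finset.mul_sum]
  exact Finset.sum_congr rfl fun y _ => by ring

lemma hasDerivAt_walkSemigroup_mulVec (v : ZMod N → ℝ) (y : ZMod N) (u : ℝ) :
    HasDerivAt (fun u => (walkSemigroup N b β u *ᵥ v) y)
      ((N : ℝ) ^ 2 * (walkMatrix N b β *ᵥ (walkSemigroup N b β u *ᵥ v)) y) u := by
  have h : HasDerivAt (fun u => ∑ z, walkSemigroup N b β u y z * v z)
      (∑ z, (((N : ℝ) ^ 2 • walkMatrix N b β) * walkSemigroup N b β u) y z * v z) u :=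
    HasDerivAt.fun_sum fun z _ => (hasDerivAt_exp_smul_matrix _ y z u).mul_const _
  have h2 : (N : ℝ) ^ 2 * (walkMatrix N b β *ᵥ (walkSemigroup N b β u *ᵥ v)) y =
      ∑ z, (((N : ℝ) ^ 2 • walkMatrix N b β) * walkSemigroup N b β u) y z * v z := by
    rw [Matrix.mulVec_mulVec, Matrix.smul_mul]
    simp only [Matrix.mulVec, dotProduct, Matrix.smul_apply, smul_eq_mul, Finset.mul_sum, mul_assoc]
  rw [h2]
  exact h

lemma continuous_walkSemigroup_mulVec (v : ZMod N → ℝ) (y : ZMod N) :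
    Continuous (fun u => (walkSemigroup N b β u *ᵥ v) y) :=
  continuous_iff_continuousAt.2 fun u => (hasDerivAt_walkSemigroup_mulVec N b β v y u).continuousAt

/-- The time integral `∫₀^τ S_u v du` along the semigroup of the random walk. -/
def walkIntegral (v : ZMod N → ℝ) (τ : ℝ) (y : ZMod N) : ℝ :=
  ∫ u in (0 : ℝ)..τ, (walkSemigroup N b β u *ᵥ v) y

lemma hasDerivAt_walkIntegral (v : ZMod N → ℝ) (τ : ℝ) (y : ZMod N) :
    HasDerivAt (fun τ => walkIntegral N b β v τ y) ((walkSemigroup N b β τ *ᵥ v) y) τ :=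
  intervalIntegral.integral_hasDerivAt_right
    ((continuous_walkSemigroup_mulVec N b β v y).intervalIntegrable _ _)
    (continuous_walkSemigroup_mulVec N b β v y).stronglyMeasurable.stronglyMeasurableAtFilter
    (continuous_walkSemigroup_mulVec N b β v y).continuousAt

/-- The backward equation integrated over `[0, τ]`. It expresses the time derivative of the walk
integral through the walk integral itself, which closes the energy estimate. -/
lemma walkSemigroup_mulVec_eq (v : ZMod N → ℝ) (τ : ℝ) (y : ZMod N) :
    (walkSemigroup N b β τ *ᵥ v) y =
      v y + (N : ℝ) ^ 2 * (walkMatrix N b β *ᵥ walkIntegral N b β v τ) y := by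
  have hint : ∀ z, IntervalIntegrable (fun u => (walkSemigroup N b β u *ᵥ v) z) volume 0 τ :=
    fun z => (continuous_walkSemigroup_mulVec N b β v z).intervalIntegrable _ _
  have h0 : walkSemigroup N b β 0 = 1 := by
    simp [walkSemigroup, NormedSpace.exp_zero]
  have hcont : Continuous fun u =>
      (N : ℝ) ^ 2 * (walkMatrix N b β *ᵥ (walkSemigroup N b β u *ᵥ v)) y := by
    have h := fun z => continuous_walkSemigroup_mulVec N b β v z
    change Continuous fun u =>
      (N : ℝ) ^ 2 * ∑ z, walkMatrix N b β y z * (walkSemigroup N b β u *ᵥ v) z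
    exact continuous_const.mul (continuous_finsetSum _ fun z _ => continuous_const.mul (h z))
  have h := intervalIntegral.integral_eq_sub_of_hasDerivAt (a := 0) (b := τ)
    (fun u _ => hasDerivAt_walkSemigroup_mulVec N b β v y u) (hcont.intervalIntegrable _ _)
  rw [h0, Matrix.one_mulVec] at h
  have h2 : (∫ u in (0 : ℝ)..τ,
      (N : ℝ) ^ 2 * (walkMatrix N b β *ᵥ (walkSemigroup N b β u *ᵥ v)) y) =
      (N : ℝ) ^ 2 * (walkMatrix N b β *ᵥ walkIntegral N b β v τ) y := by
    rw [intervalIntegral.integral_const_mul]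
    congr 1
    change (∫ u in (0 : ℝ)..τ, ∑ z, walkMatrix N b β y z * (walkSemigroup N b β u *ᵥ v) z) =
      ∑ z, walkMatrix N b β y z * walkIntegral N b β v τ z
    rw [intervalIntegral.integral_finsetSum fun z _ => (hint z).const_mul _]
    simp only [intervalIntegral.integral_const_mul]
    rfl
  linarith

variable {N b β}

/-- If `R` bounds the effective resistance seen by `v`, then the time integral of the speeded up
walk started from `v` is small in `ℓ²`. -/
lemma sum_sq_walkIntegral_le {v : ZMod N → ℝ} {R : ℝ} (hR0 : 0 ≤ R)
    (hR : ∀ g : ZMod N → ℝ, (∑ y, v y * g y) ^ 2 ≤ R * dirichlet N b β g) {τ : ℝ} (hτ : 0 ≤ τ) :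
    ∑ y, walkIntegral N b β v τ y ^ 2 ≤ R / (2 * (N : ℝ) ^ 2) * τ := by
  have hN : (0 : ℝ) < N := by exact_mod_cast NeZero.pos N
  have hderiv : ∀ s, HasDerivAt (fun s => ∑ y, walkIntegral N b β v s y ^ 2)
      (∑ y, 2 * walkIntegral N b β v s y * (walkSemigroup N b β s *ᵥ v) y) s := by
    intro s
    refine HasDerivAt.fun_sum fun y _ => ?_
    have := (hasDerivAt_walkIntegral N b β v s y).fun_pow 2
    simpa using this
  have hbound : ∀ s, ∑ y, 2 * walkIntegral N b β v s y * (walkSemigroup N b β s *ᵥ v) y ≤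
      R / (2 * (N : ℝ) ^ 2) := by
    intro s
    set g := walkIntegral N b β v s with hg
    -- Energy identity: d/ds ‖g‖² = 2⟨v,g⟩ − 2N² D(g).
    have h1 : ∑ y, 2 * g y * (walkSemigroup N b β s *ᵥ v) y =
        2 * ∑ y, v y * g y - 2 * (N : ℝ) ^ 2 * dirichlet N b β g := by
      have h2 := sum_mul_walkMatrix_mulVec N b β g
      have h3 : dirichlet N b β g = -∑ y, g y * (walkMatrix N b β *ᵥ g) y := by rw [h2, neg_neg]
      rw [h3, mul_neg, sub_neg_eq_add, Finset.mul_sum, Finset.mul_sum, ← Finset.sum_add_distrib]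
      refine Finset.sum_congr rfl fun y _ => ?_
      rw [walkSemigroup_mulVec_eq]
      ring
    rw [h1, le_div_iff₀ (by positivity)]
    have h4 := hR g
    have hD := dirichlet_nonneg N b β g
    rcases hD.eq_or_lt with h0 | hpos
    · have h5 : (∑ y, v y * g y) = 0 := by
        rw [← h0, mul_zero] at h4
        exact pow_eq_zero_iff (two_ne_zero) |>.1 (le_antisymm h4 (sq_nonneg _))
      rw [h5, ← h0]; simpa using hR0
    · have h6 : R ≥ (∑ y, v y * g y) ^ 2 / dirichlet N b β g := by
        rw [ge_iff_le, div_le_iff₀ hpos]; exact h4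
      refine le_trans ?_ h6
      rw [le_div_iff₀ hpos]
      -- Young's inequality: 2a − 2N²D ≤ a²/(2N²D) with a = ⟨v,g⟩.
      nlinarith [sq_nonneg ((∑ y, v y * g y) - 2 * (N : ℝ) ^ 2 * dirichlet N b β g)]
  have h := Convex.image_sub_le_mul_sub_of_deriv_le (convex_univ)
    (f := fun s => ∑ y, walkIntegral N b β v s y ^ 2)
    (continuous_iff_continuousAt.2 fun s => (hderiv s).continuousAt).continuousOn
    (fun s _ => (hderiv s).differentiableAt.differentiableWithinAt)
    (fun s _ => (hderiv s).deriv.trans_le (hbound s)) 0 (Set.mem_univ _) τ (Set.mem_univ _) hτ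
  simpa [walkIntegral] using h

lemma sum_abs_walkIntegral_le {v : ZMod N → ℝ} {R : ℝ} (hR0 : 0 ≤ R)
    (hR : ∀ g : ZMod N → ℝ, (∑ y, v y * g y) ^ 2 ≤ R * dirichlet N b β g) {τ : ℝ} (hτ : 0 ≤ τ) :
    ∑ y, |walkIntegral N b β v τ y| ≤ √(R / (2 * N) * τ) := by
  have hN : (0 : ℝ) < N := by exact_mod_cast NeZero.pos N
  refine Real.le_sqrt_of_sq_le ?_
  refine sq_sum_le_card_mul_sum_sq.trans ?_
  simp only [sq_abs, Finset.card_univ, ZMod.card]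
  refine (mul_le_mul_of_nonneg_left (sum_sq_walkIntegral_le hR0 hR hτ) hN.le).trans_eq ?_
  field_simp

end Dual

/-! ### Two-time correlations of the process and the second moment of time integrals -/

section Law

open scoped Matrix

variable {N : ℕ} {k : ℕ} {b : Fin k → UnitAddCircle} {β : ℝ}

lemma measurable_eval (s : ℝ≥0) : Measurable fun ω : PathSpace N => ω.1 s :=
  (measurable_pi_apply s).comp measurable_subtype_coe

variable [NeZero N]

lemma measurableSet_eval_eq (s : ℝ≥0) (a : Config N) :
    MeasurableSet {ω : PathSpace N | ω.1 s = a} :=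
  measurable_eval s (measurableSet_singleton a)

/-- The Markov property at two times. -/
lemma IsExclusionLaw.measure_two_times {μ : Measure (Config N)} {P : Measure (PathSpace N)}
    (hP : IsExclusionLaw N b β μ P) {s r : ℝ≥0} (hsr : s ≤ r) (a c : Config N) :
    P {ω | ω.1 s = a ∧ ω.1 r = c} =
      P {ω | ω.1 s = a} * ENNReal.ofReal (transition N b β ((r : ℝ) - s) a c) := by
  -- `fdd` only covers time sequences that start at 0, so the initial state is inserted and summed
  -- out.
  have hsum : ∀ A : Set (PathSpace N), MeasurableSet A →
      P A = ∑ c, P ({ω | ω.1 0 = c} ∩ A) := by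
    intro A hA
    rw [← measure_biUnion_finset]
    · congr 1
      ext ω
      simp
    · intro c₁ _ c₂ _ h
      rw [Function.onFun, Set.disjoint_left]
      rintro ω ⟨h1, -⟩ ⟨h2, -⟩
      exact h (h1.symm.trans h2)
    · exact fun c _ => (measurableSet_eval_eq 0 c).inter hA
  have h1 : ∀ d, P ({ω | ω.1 0 = d} ∩ {ω | ω.1 s = a}) =
      μ {d} * ENNReal.ofReal (transition N b β s d a) := by
    intro d
    have h := hP.fdd 1 (fun i => if i = 0 then 0 else s) rfl
      (fun i j hij => by dsimp only; split_ifs <;> simp_all) (fun i => if i = 0 then d else a)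
    simp only [Finset.prod_range_one] at h
    simp only [zero_add, one_ne_zero, if_true, if_false, NNReal.coe_zero, sub_zero] at h
    rw [← h]
    congr 1
    ext ω
    simp only [Set.mem_inter_iff, Set.mem_ofPred_eq]
    constructor
    · rintro ⟨h1, h2⟩ i hi
      interval_cases i <;> simp_all
    · intro h
      exact ⟨by simpa using h 0 (by norm_num), by simpa using h 1 le_rfl⟩
  have h2 : ∀ d, P ({ω | ω.1 0 = d} ∩ {ω | ω.1 s = a ∧ ω.1 r = c}) =
      μ {d} * ENNReal.ofReal (transition N b β s d a * transition N b β ((r : ℝ) - s) a c) := by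
    intro d
    have h := hP.fdd 2 (fun i => if i = 0 then 0 else if i = 1 then s else r) rfl
      (fun i j hij => by
        dsimp only
        split_ifs <;> first | exact le_rfl | exact hsr | positivity | (exfalso; lia))
      (fun i => if i = 0 then d else if i = 1 then a else c)
    simp only [Finset.prod_range_succ, Finset.prod_range_zero, one_mul] at h
    simp only [zero_add, one_ne_zero, if_true, if_false, NNReal.coe_zero, sub_zero,
      Nat.reduceAdd, OfNat.ofNat_ne_zero, OfNat.ofNat_ne_one] at h
    rw [← h]
    congr 1
    ext ω
    simp only [Set.mem_inter_iff, Set.mem_ofPred_eq]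
    constructor
    · rintro ⟨h1, h2, h3⟩ i hi
      interval_cases i <;> simp_all
    · intro h
      exact ⟨by simpa using h 0 (by norm_num), by simpa using h 1 (by norm_num),
        by simpa using h 2 le_rfl⟩
  rw [hsum {ω | ω.1 s = a ∧ ω.1 r = c}
      ((measurableSet_eval_eq s a).inter (measurableSet_eval_eq r c)), hsum _ (measurableSet_eval_eq s a), Finset.sum_mul]
  refine Finset.sum_congr rfl fun d _ => ?_
  rw [h1]
  refine (h2 d).trans ?_
  rw [ENNReal.ofReal_mul (transition_nonneg N b β s.coe_nonneg d a), mul_assoc]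

lemma integral_eval_two_times (P : Measure (PathSpace N)) [IsProbabilityMeasure P] (s r : ℝ≥0)
    (F : Config N → Config N → ℝ) :
    ∫ ω, F (ω.1 s) (ω.1 r) ∂P = ∑ a, ∑ c, P.real {ω | ω.1 s = a ∧ ω.1 r = c} * F a c := by
  have hm : Measurable fun ω : PathSpace N => (ω.1 s, ω.1 r) :=
    (measurable_eval s).prodMk (measurable_eval r)
  have hprob : IsProbabilityMeasure (P.map fun ω : PathSpace N => (ω.1 s, ω.1 r)) :=
    Measure.isProbabilityMeasure_map hm.aemeasurable
  have hF : Measurable fun p : Config N × Config N => F p.1 p.2 := measurable_of_countable _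
  rw [show (∫ ω, F (ω.1 s) (ω.1 r) ∂P) =
      ∫ p, F p.1 p.2 ∂(P.map fun ω : PathSpace N => (ω.1 s, ω.1 r)) from
    (integral_map hm.aemeasurable hF.aestronglyMeasurable).symm]
  rw [integral_fintype Integrable.of_finite, Fintype.sum_prod_type]
  refine Finset.sum_congr rfl fun a _ => Finset.sum_congr rfl fun c _ => ?_
  rw [map_measureReal_apply hm (measurableSet_singleton _), smul_eq_mul]
  congr 2
  ext ω
  simp

/-- The two-time correlations of a linear functional of the process. -/
lemma IsExclusionLaw.integral_linear_mul_linear {μ : Measure (Config N)}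
    {P : Measure (PathSpace N)} (hP : IsExclusionLaw N b β μ P) {s r : ℝ≥0} (hsr : s ≤ r)
    (v : ZMod N → ℝ) :
    ∫ ω, (∑ y, v y * occ (ω.1 s) y) * (∑ y, v y * occ (ω.1 r) y) ∂P =
      ∑ a, P.real {ω | ω.1 s = a} * ((∑ y, v y * occ a y) *
        ∑ y, (walkSemigroup N b β ((r : ℝ) - s) *ᵥ v) y * occ a y) := by
  have := hP.isProbabilityMeasure
  have hsr' : 0 ≤ (r : ℝ) - s := sub_nonneg.2 (by exact_mod_cast hsr)
  rw [integral_eval_two_times P s r fun a c => (∑ y, v y * occ a y) * (∑ y, v y * occ c y)]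
  refine Finset.sum_congr rfl fun a _ => ?_
  rw [← transition_mulVec_linear, Finset.mul_sum, Finset.mul_sum]
  refine Finset.sum_congr rfl fun c _ => ?_
  rw [measureReal_def, hP.measure_two_times hsr, ENNReal.toReal_mul,
    ENNReal.toReal_ofReal (transition_nonneg N b β hsr' a c), measureReal_def]
  ring

lemma occ_nonneg {N : ℕ} (η : Config N) (x : ZMod N) : 0 ≤ occ η x := Nat.cast_nonneg _

lemma occ_le_one {N : ℕ} (η : Config N) (x : ZMod N) : occ η x ≤ 1 := by
  unfold occ
  exact_mod_cast Nat.lt_succ_iff.1 (η x).2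

/-- A real function of the process, jointly measurable in time and in the trajectory. -/
lemma measurable_comp_path (F : Config N → ℝ) :
    Measurable fun p : ℝ × PathSpace N => F (p.2.1 p.1.toNNReal) := by
  have hF : Continuous F := continuous_of_discreteTopology
  -- Discretised times rounded up: they approach `s.toNNReal` from the right, the side on which
  -- paths are continuous. The `+ 1` keeps them from falling below it.
  let a : ℕ → ℝ → ℝ≥0 := fun n s => ((⌊((n : ℝ) + 1) * s⌋₊ : ℝ≥0) + 1) / ((n : ℝ≥0) + 1)
  refine measurable_of_tendsto_metrizable
    (f := fun n (p : ℝ × PathSpace N) => F (p.2.1 (a n p.1))) (fun n => ?_) ?_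
  · have h1 : Measurable fun q : ℕ × PathSpace N =>
        F (q.2.1 (((q.1 : ℝ≥0) + 1) / ((n : ℝ≥0) + 1))) :=
      measurable_from_prod_countable_right fun m =>
        (measurable_of_countable F).comp (measurable_eval (((m : ℝ≥0) + 1) / ((n : ℝ≥0) + 1)))
    have h2 : Measurable fun p : ℝ × PathSpace N => (⌊((n : ℝ) + 1) * p.1⌋₊, p.2) :=
      (Nat.measurable_floor.comp (measurable_const.mul measurable_fst)).prodMk measurable_snd
    exact h1.comp h2
  · rw [tendsto_pi_nhds]
    rintro ⟨s, ω⟩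
    have hn : ∀ n : ℕ, (0 : ℝ) < (n : ℝ) + 1 := fun n => by positivity
    have hge : ∀ n, s.toNNReal ≤ a n s := by
      intro n
      rw [Real.toNNReal_le_iff_le_coe]
      simp only [a, NNReal.coe_div, NNReal.coe_add, NNReal.coe_natCast, NNReal.coe_one]
      rw [le_div_iff₀ (hn n), mul_comm]
      exact (Nat.lt_floor_add_one _).le
    have hle : ∀ n, (a n s : ℝ) ≤ s.toNNReal + 1 / ((n : ℝ) + 1) := by
      intro n
      simp only [a, NNReal.coe_div, NNReal.coe_add, NNReal.coe_natCast, NNReal.coe_one]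
      rw [add_div]
      gcongr
      rw [div_le_iff₀ (hn n)]
      rcases le_total 0 s with h | h
      · rw [Real.coe_toNNReal s h, mul_comm]
        exact Nat.floor_le (mul_nonneg h (hn n).le)
      · rw [Nat.floor_of_nonpos (mul_nonpos_of_nonneg_of_nonpos (hn n).le h)]
        simp only [Nat.cast_zero]
        positivity
    have hlim : Tendsto (fun n => a n s) atTop (𝓝[≥] s.toNNReal) := by
      refine tendsto_nhdsWithin_iff.2 ⟨?_, Eventually.of_forall hge⟩
      rw [← NNReal.tendsto_coe]
      refine tendsto_of_tendsto_of_tendsto_of_le_of_le tendsto_const_nhds ?_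
        (fun n => NNReal.coe_le_coe.2 (hge n)) hle
      simpa using (tendsto_one_div_add_atTop_nhds_zero_nat (𝕜 := ℝ)).const_add (s.toNNReal : ℝ)
    exact (hF.tendsto _).comp (((ω.2 s.toNNReal).1.tendsto).comp hlim)

/-- The second moment of the time integral of a bounded process, in terms of its correlations. -/
lemma integral_sq_integral_le {Ω : Type*} [MeasurableSpace Ω] {P : Measure Ω}
    [IsProbabilityMeasure P] {Z : ℝ → Ω → ℝ} (hZ : Measurable fun p : ℝ × Ω => Z p.1 p.2)
    (hb : ∀ s ω, |Z s ω| ≤ 1) {t K : ℝ} (ht : 0 ≤ t)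
    (hK : ∀ s, 0 ≤ s → s ≤ t → ∫ r in s..t, (∫ ω, Z s ω * Z r ω ∂P) ≤ K) :
    ∫ ω, (∫ s in (0 : ℝ)..t, Z s ω) ^ 2 ∂P ≤ 2 * t * K := by
  set ν : Measure ℝ := volume.restrict (Set.Ioc 0 t) with hν
  have hfin : IsFiniteMeasure ν := by rw [hν]; infer_instance
  set c : ℝ → ℝ → ℝ := fun s r => ∫ ω, Z s ω * Z r ω ∂P with hc
  have hbb : ∀ s r ω, |Z s ω * Z r ω| ≤ 1 := fun s r ω => by
    rw [abs_mul]; exact mul_le_one₀ (hb s ω) (abs_nonneg _) (hb r ω)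
  have hmeas3 : Measurable fun p : (ℝ × ℝ) × Ω => Z p.1.1 p.2 * Z p.1.2 p.2 :=
    (hZ.comp ((measurable_fst.comp measurable_fst).prodMk measurable_snd)).mul
      (hZ.comp ((measurable_snd.comp measurable_fst).prodMk measurable_snd))
  have hcm : StronglyMeasurable (fun p : ℝ × ℝ => c p.1 p.2) :=
    hmeas3.stronglyMeasurable.integral_prod_right'
  have hcb : ∀ s r, |c s r| ≤ 1 := by
    intro s r
    have := norm_integral_le_of_norm_le_const (μ := P) (f := fun ω => Z s ω * Z r ω) (C := 1)
      (Eventually.of_forall fun ω => by rw [Real.norm_eq_abs]; exact hbb s r ω)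
    simpa using this
  have hci : Integrable (fun p : ℝ × ℝ => c p.1 p.2) (ν.prod ν) :=
    Integrable.of_bound hcm.aestronglyMeasurable 1 (Eventually.of_forall fun p => hcb p.1 p.2)
  have hsym : ∀ s r, c s r = c r s := fun s r => by simp only [hc, mul_comm]
  have h1 : ∫ ω, (∫ s in (0 : ℝ)..t, Z s ω) ^ 2 ∂P = ∫ p, c p.1 p.2 ∂(ν.prod ν) := by
    have hswap := integral_integral_swap (μ := P) (ν := ν.prod ν)
      (f := fun ω (p : ℝ × ℝ) => Z p.1 ω * Z p.2 ω)
      (Integrable.of_bound (hmeas3.comp measurable_swap).aestronglyMeasurable 1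
        (Eventually.of_forall fun p => hbb _ _ _))
    rw [← hswap]
    refine integral_congr_ae (Eventually.of_forall fun ω => ?_)
    simp only
    rw [integral_prod_mul (fun s => Z s ω) (fun s => Z s ω), sq,
      intervalIntegral.integral_of_le ht]
  have hA : MeasurableSet {p : ℝ × ℝ | p.1 ≤ p.2} := measurableSet_le measurable_fst measurable_snd
  have hB : MeasurableSet {p : ℝ × ℝ | p.1 < p.2} := measurableSet_lt measurable_fst measurable_snd
  -- The square is cut along its diagonal, and by symmetry of `c` the lower triangle is reflected
  -- onto the upper one; this is the source of the factor 2.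
  have h2 : ∫ p, c p.1 p.2 ∂(ν.prod ν) =
      ∫ p in {p : ℝ × ℝ | p.1 ≤ p.2}, c p.1 p.2 ∂(ν.prod ν) +
        ∫ p in {p : ℝ × ℝ | p.1 < p.2}, c p.1 p.2 ∂(ν.prod ν) := by
    rw [← integral_add_compl hA hci]
    congr 1
    rw [← integral_indicator hA.compl, ← integral_indicator hB, ← integral_prod_swap]
    refine integral_congr_ae (Eventually.of_forall fun p => ?_)
    simp only [Set.indicator, Set.mem_compl_iff, Set.mem_ofPred_eq, Prod.fst_swap, Prod.snd_swap,
      not_le, hsym p.2 p.1]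
  have h3 : ∀ (S : ℝ → Set ℝ), MeasurableSet {p : ℝ × ℝ | p.2 ∈ S p.1} →
      (∀ s, 0 < s → s ≤ t → (S s ∩ Set.Ioc 0 t : Set ℝ) =ᵐ[volume] Set.Ioc s t) →
      ∫ p in {p : ℝ × ℝ | p.2 ∈ S p.1}, c p.1 p.2 ∂(ν.prod ν) ≤ t * K := by
    intro S hS hSae
    rw [← integral_indicator hS, integral_prod _ (hci.indicator hS)]
    have hle : ∀ᵐ s ∂ν, ∫ r, {p : ℝ × ℝ | p.2 ∈ S p.1}.indicator (fun p => c p.1 p.2) (s, r) ∂ν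
        ≤ K := by
      filter_upwards [ae_restrict_mem measurableSet_Ioc] with s hs
      have hSs : MeasurableSet (S s) := measurable_prodMk_left (x := s) hS
      have : (fun r => {p : ℝ × ℝ | p.2 ∈ S p.1}.indicator (fun p => c p.1 p.2) (s, r)) =
          (S s).indicator (c s) := by
        ext r; simp [Set.indicator]
      rw [this, integral_indicator hSs, hν, Measure.restrict_restrict hSs,
        Measure.restrict_congr_set (hSae s hs.1 hs.2), ← intervalIntegral.integral_of_le hs.2]
      exact hK s hs.1.le hs.2
    refine (integral_mono_ae (hci.indicator hS).integral_prod_left (integrable_const K)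
      hle).trans_eq ?_
    simp [hν, ht]
  have h4 := h3 (fun s => Set.Ici s) hA (fun s hs hst => by
    have : Set.Ici s ∩ Set.Ioc 0 t = Set.Icc s t := by
      ext r; simp only [Set.mem_inter_iff, Set.mem_Ici, Set.mem_Ioc, Set.mem_Icc]
      exact ⟨fun h => ⟨h.1, h.2.2⟩, fun h => ⟨h.1, hs.trans_le h.1, h.2⟩⟩
    rw [this]; exact Ioc_ae_eq_Icc.symm)
  have h5 := h3 (fun s => Set.Ioi s) hB (fun s hs hst => by
    have : Set.Ioi s ∩ Set.Ioc 0 t = Set.Ioc s t := by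
      ext r; simp only [Set.mem_inter_iff, Set.mem_Ioi, Set.mem_Ioc]
      exact ⟨fun h => ⟨h.1, h.2.2⟩, fun h => ⟨h.1, hs.trans h.1, h.2⟩⟩
    rw [this]; exact ae_eq_refl _)
  rw [h1, h2]
  simp only [Set.mem_Ici, Set.mem_Ioi] at h4 h5
  linarith

/-- E|X| ≤ √E[X²], obtained by integrating (|X| − m)² ≥ 0 with m = E|X|. -/
lemma lintegral_abs_le_sqrt {Ω : Type*} [MeasurableSpace Ω] {P : Measure Ω}
    [IsProbabilityMeasure P] {X : Ω → ℝ} (hX : Measurable X) {C : ℝ} (hC : ∀ ω, |X ω| ≤ C)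
    {B : ℝ} (hB : ∫ ω, X ω ^ 2 ∂P ≤ B) :
    ∫⁻ ω, ENNReal.ofReal |X ω| ∂P ≤ ENNReal.ofReal √B := by
  have hi : Integrable (fun ω => |X ω|) P :=
    Integrable.of_bound hX.abs.aestronglyMeasurable C
      (Eventually.of_forall fun ω => by simpa using hC ω)
  have hi2 : Integrable (fun ω => X ω ^ 2) P :=
    Integrable.of_bound (hX.pow_const 2).aestronglyMeasurable (C ^ 2)
      (Eventually.of_forall fun ω => by
        rw [norm_pow, Real.norm_eq_abs]; exact pow_le_pow_left₀ (abs_nonneg _) (hC ω) 2)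
  rw [← ofReal_integral_eq_lintegral_ofReal hi (Eventually.of_forall fun ω => abs_nonneg _)]
  refine ENNReal.ofReal_le_ofReal (Real.le_sqrt_of_sq_le (le_trans ?_ hB))
  set m := ∫ ω, |X ω| ∂P with hm
  have h : ∀ ω, 2 * m * |X ω| - m ^ 2 ≤ X ω ^ 2 := fun ω => by
    nlinarith [sq_nonneg (|X ω| - m), sq_abs (X ω)]
  have h2 := integral_mono ((hi.const_mul (2 * m)).sub (integrable_const (m ^ 2))) hi2 h
  simp only [Pi.sub_apply] at h2
  rw [integral_sub (hi.const_mul _) (integrable_const _), integral_const_mul, ← hm] at h2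
  simp only [integral_const, probReal_univ, one_smul] at h2
  linarith

/-- The main estimate: a linear functional with small effective resistance has a small time
integral along the exclusion process, whatever the initial distribution. -/
lemma IsExclusionLaw.lintegral_abs_integral_le {μ : Measure (Config N)}
    {P : Measure (PathSpace N)} (hP : IsExclusionLaw N b β μ P) {v : ZMod N → ℝ} {R : ℝ}
    (hR0 : 0 ≤ R) (hR : ∀ g : ZMod N → ℝ, (∑ y, v y * g y) ^ 2 ≤ R * dirichlet N b β g)
    {V : Config N → ℝ} (hV : ∀ η, V η = ∑ y, v y * occ η y) (hV1 : ∀ η, |V η| ≤ 1)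
    {t : ℝ} (ht : 0 ≤ t) :
    ∫⁻ ω, ENNReal.ofReal |∫ s in (0 : ℝ)..t, V (ω.1 s.toNNReal)| ∂P ≤
      ENNReal.ofReal √(2 * t * √(R / (2 * N) * t)) := by
  have := hP.isProbabilityMeasure
  have hN : (0 : ℝ) < N := by exact_mod_cast NeZero.pos N
  have hmeas := measurable_comp_path V
  refine lintegral_abs_le_sqrt (C := t) ?_ ?_ ?_
  · have : StronglyMeasurable fun ω : PathSpace N =>
        ∫ s, V (ω.1 s.toNNReal) ∂(volume.restrict (Set.Ioc 0 t)) :=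
      (hmeas.comp measurable_swap).stronglyMeasurable.integral_prod_right'
    simpa only [intervalIntegral.integral_of_le ht] using this.measurable
  · intro ω
    have := intervalIntegral.norm_integral_le_of_norm_le_const (a := 0) (b := t) (C := 1)
      (f := fun s : ℝ => V (ω.1 s.toNNReal)) fun s _ => hV1 _
    simpa [abs_of_nonneg ht] using this
  · refine integral_sq_integral_le (Z := fun s (ω : PathSpace N) => V (ω.1 s.toNNReal)) hmeas
      (fun s ω => hV1 _) ht fun s hs hst => ?_
    have hint : ∀ y, IntervalIntegrable (fun r => (walkSemigroup N b β (r - s) *ᵥ v) y)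
        volume s t := fun y =>
      ((continuous_walkSemigroup_mulVec N b β v y).comp
        (continuous_id.sub continuous_const)).intervalIntegrable _ _
    have hint' : ∀ a : Config N, IntervalIntegrable
        (fun r => ∑ y, (walkSemigroup N b β (r - s) *ᵥ v) y * occ a y) volume s t := fun a =>
      (continuous_finsetSum _ fun y _ => ((continuous_walkSemigroup_mulVec N b β v y).comp
        (continuous_id.sub continuous_const)).mul continuous_const).intervalIntegrable _ _
    have h1 : ∫ r in s..t, (∫ ω, V (ω.1 s.toNNReal) * V (ω.1 r.toNNReal) ∂P) =
        ∫ r in s..t, ∑ a, P.real {ω | ω.1 s.toNNReal = a} * (V a *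
          ∑ y, (walkSemigroup N b β (r - s) *ᵥ v) y * occ a y) := by
      refine intervalIntegral.integral_congr fun r hr => ?_
      rw [Set.uIcc_of_le hst] at hr
      have h2 := hP.integral_linear_mul_linear (Real.toNNReal_le_toNNReal hr.1) v
      simp only [← hV] at h2
      rw [Real.coe_toNNReal _ hs, Real.coe_toNNReal _ (hs.trans hr.1)] at h2
      exact h2
    have h3 : ∀ y, ∫ r in s..t, (walkSemigroup N b β (r - s) *ᵥ v) y =
        walkIntegral N b β v (t - s) y := by
      intro y
      rw [intervalIntegral.integral_comp_sub_right (fun r => (walkSemigroup N b β r *ᵥ v) y),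
        sub_self, walkIntegral]
    rw [h1, intervalIntegral.integral_finsetSum fun a _ =>
      ((hint' a).const_mul _).const_mul _]
    simp only [intervalIntegral.integral_const_mul]
    have h4 : ∀ a : Config N,
        ∫ r in s..t, ∑ y, (walkSemigroup N b β (r - s) *ᵥ v) y * occ a y =
          ∑ y, walkIntegral N b β v (t - s) y * occ a y := by
      intro a
      rw [intervalIntegral.integral_finsetSum fun y _ => (hint y).mul_const _]
      simp only [intervalIntegral.integral_mul_const, h3]
    simp only [h4]
    set K := ∑ y, |walkIntegral N b β v (t - s) y| with hK
    -- The bound holds for each state `a`, so the law at time `s` enters only through its total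
    -- mass.
    have h5 : ∀ a, V a * ∑ y, walkIntegral N b β v (t - s) y * occ a y ≤ K := by
      intro a
      refine (le_abs_self _).trans ?_
      rw [abs_mul]
      refine (mul_le_of_le_one_left (abs_nonneg _) (hV1 a)).trans ?_
      refine (Finset.abs_sum_le_sum_abs _ _).trans (Finset.sum_le_sum fun y _ => ?_)
      rw [abs_mul, abs_of_nonneg (occ_nonneg a y)]
      exact mul_le_of_le_one_right (abs_nonneg _) (occ_le_one a y)
    have h6 : ∑ a, P.real {ω : PathSpace N | ω.1 s.toNNReal = a} = 1 := by
      have h7 := integral_eval_two_times P s.toNNReal s.toNNReal fun _ _ => 1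
      simp only [integral_const, probReal_univ, one_smul, mul_one] at h7
      rw [h7]
      refine Finset.sum_congr rfl fun a _ => ?_
      rw [Finset.sum_eq_single a]
      · simp
      · intro c _ hc
        have : {ω : PathSpace N | ω.1 s.toNNReal = a ∧ ω.1 s.toNNReal = c} = ∅ := by
          ext ω
          simp only [Set.mem_ofPred_eq, Set.mem_empty_iff_false, iff_false]
          rintro ⟨h, h'⟩
          exact hc (h'.symm.trans h)
        rw [this, measureReal_empty]
      · simp
    calc _ ≤ ∑ a, P.real {ω : PathSpace N | ω.1 s.toNNReal = a} * K :=
          Finset.sum_le_sum fun a _ => mul_le_mul_of_nonneg_left (h5 a) measureReal_nonneg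
      _ = K := by rw [← Finset.sum_mul, h6, one_mul]
      _ ≤ √(R / (2 * N) * (t - s)) := sum_abs_walkIntegral_le hR0 hR (sub_nonneg.2 hst)
      _ ≤ √(R / (2 * N) * t) := by
          apply Real.sqrt_le_sqrt
          gcongr
          linarith

end Law

/-! ### Resistance of lattice paths and the position of slow bonds -/

section Resistance

variable {N : ℕ} {k : ℕ} {b : Fin k → UnitAddCircle} {β : ℝ}

lemma injOn_add_natCast (w : ZMod N) : Set.InjOn (fun l : ℕ => w + (l : ZMod N)) (Set.Iio N) := by
  intro i hi j hj hij
  have h : (i : ZMod N) = j := add_left_cancel hij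
  rw [ZMod.natCast_eq_natCast_iff'] at h
  rwa [Nat.mod_eq_of_lt hi, Nat.mod_eq_of_lt hj] at h

variable (N b β) in
/-- The resistance of the path of `ℓ` bonds that starts at `w`. -/
def pathResistance (w : ZMod N) (ℓ : ℕ) : ℝ :=
  ∑ l ∈ Finset.range ℓ, (conductance N b β (w + l))⁻¹

lemma pathResistance_of_not_isSlowBond {w : ZMod N} {ℓ : ℕ}
    (h : ∀ l < ℓ, ¬ IsSlowBond N b (w + (l : ZMod N))) : pathResistance N b β w ℓ = ℓ := by
  unfold pathResistance
  rw [Finset.sum_congr rfl (g := fun _ => (1 : ℝ))]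
  · simp
  · intro l hl
    rw [conductance, if_neg (h l (Finset.mem_range.1 hl)), inv_one]

open Classical in
lemma inv_conductance_le (x : ZMod N) :
    (conductance N b β x)⁻¹ ≤
      1 + ∑ i, if IsLeftVertex N (b i) x then (N : ℝ) ^ β else 0 := by
  have hN : (0 : ℝ) ≤ N := Nat.cast_nonneg N
  have hnn : ∀ i, 0 ≤ if IsLeftVertex N (b i) x then (N : ℝ) ^ β else 0 := fun i => by
    split_ifs <;> positivity
  unfold conductance
  split_ifs with h
  · obtain ⟨i, hi⟩ := h
    have h1 := Finset.single_le_sum (f := fun i => if IsLeftVertex N (b i) x then (N : ℝ) ^ β else 0)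
      (fun i _ => hnn i) (Finset.mem_univ i)
    simp only [hi, if_true] at h1
    rw [Real.rpow_neg hN, inv_inv]
    linarith
  · have := Finset.sum_nonneg fun i (_ : i ∈ Finset.univ) => hnn i
    rw [inv_one]
    linarith

lemma abs_sub_le_sum_abs {w : ZMod N} (g : ZMod N → ℝ) {ℓ i j : ℕ} (hi : i ≤ ℓ) (hj : j ≤ ℓ) :
    |g (w + i) - g (w + j)| ≤ ∑ l ∈ Finset.range ℓ, |g (w + l + 1) - g (w + l)| := by
  wlog hij : i ≤ j generalizing i j
  · rw [abs_sub_comm]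
    exact this hj hi (le_of_not_ge hij)
  have h := Finset.sum_Ico_sub (fun l : ℕ => g (w + l)) hij
  rw [abs_sub_comm, ← h]
  refine (Finset.abs_sum_le_sum_abs _ _).trans ?_
  refine (Finset.sum_le_sum_of_subset_of_nonneg (t := Finset.range ℓ) ?_
    fun _ _ _ => abs_nonneg _).trans_eq ?_
  · intro l hl
    rw [Finset.mem_Ico] at hl
    exact Finset.mem_range.2 (hl.2.trans_le hj)
  · simp only [Nat.cast_add, Nat.cast_one, add_assoc]

lemma abs_occ_sub_boxMean_le_one (ℓ : ℕ) (η : Config N) (x w : ZMod N) :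
    |occ η x - boxMean ℓ η w| ≤ 1 := by
  have h0 : 0 ≤ boxMean ℓ η w :=
    mul_nonneg (by positivity) (Finset.sum_nonneg fun j _ => occ_nonneg η _)
  have h1 : boxMean ℓ η w ≤ 1 := by
    have : ∑ j ∈ Finset.Icc 1 ℓ, occ η (w + (j : ZMod N)) ≤ ℓ :=
      (Finset.sum_le_card_nsmul _ _ 1 fun j _ => occ_le_one η _).trans_eq (by simp)
    unfold boxMean
    rw [one_div_mul_eq_div]
    exact div_le_one_of_le₀ this (Nat.cast_nonneg _)
  have h2 := occ_nonneg η x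
  have h3 := occ_le_one η x
  rw [abs_le]
  constructor <;> linarith

variable [NeZero N]

lemma pathResistance_nonneg (w : ZMod N) (ℓ : ℕ) : 0 ≤ pathResistance N b β w ℓ :=
  Finset.sum_nonneg fun _ _ => inv_nonneg.2 (conductance_pos N b β _).le

/-- Cauchy–Schwarz with the conductances as weights. As `ℓ ≤ N`, the path uses no bond twice, so its
energy is part of the Dirichlet form. -/
lemma sq_sum_abs_le (w : ZMod N) {ℓ : ℕ} (hℓ : ℓ ≤ N) (g : ZMod N → ℝ) :
    (∑ l ∈ Finset.range ℓ, |g (w + l + 1) - g (w + l)|) ^ 2 ≤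
      pathResistance N b β w ℓ * dirichlet N b β g := by
  have hpos := conductance_pos N b β
  have h1 : (∑ l ∈ Finset.range ℓ, |g (w + l + 1) - g (w + l)|) ^ 2 ≤
      pathResistance N b β w ℓ * ∑ l ∈ Finset.range ℓ,
        conductance N b β (w + l) * (g (w + l + 1) - g (w + l)) ^ 2 := by
    refine Finset.sum_sq_le_sum_mul_sum_of_sq_le_mul _ (fun l _ => inv_nonneg.2 (hpos _).le)
      (fun l _ => mul_nonneg (hpos _).le (sq_nonneg _)) fun l _ => ?_
    rw [sq_abs, inv_mul_cancel_left₀ (hpos _).ne']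
  refine h1.trans (mul_le_mul_of_nonneg_left ?_ (pathResistance_nonneg w ℓ))
  have hinj : Set.InjOn (fun l : ℕ => w + (l : ZMod N)) (Finset.range ℓ) :=
    (injOn_add_natCast w).mono fun _ hl =>
      (Finset.mem_range.1 (Finset.mem_coe.1 hl)).trans_le hℓ
  rw [← Finset.sum_image (f := fun x => conductance N b β x * (g (x + 1) - g x) ^ 2) hinj]
  exact Finset.sum_le_sum_of_subset_of_nonneg (Finset.subset_univ _)
    fun x _ _ => mul_nonneg (hpos _).le (sq_nonneg _)

/-- The coefficients of the linear functional `η(x) - boxMean ℓ η w`. -/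
def boxCoeff (ℓ : ℕ) (x w : ZMod N) (y : ZMod N) : ℝ :=
  (Pi.single x 1 : ZMod N → ℝ) y -
    1 / (ℓ : ℝ) * ∑ j ∈ Finset.Icc 1 ℓ, (Pi.single (w + (j : ZMod N)) 1 : ZMod N → ℝ) y

lemma sum_boxCoeff_mul (ℓ : ℕ) (x w : ZMod N) (g : ZMod N → ℝ) :
    ∑ y, boxCoeff ℓ x w y * g y =
      g x - 1 / (ℓ : ℝ) * ∑ j ∈ Finset.Icc 1 ℓ, g (w + (j : ZMod N)) := by
  simp only [boxCoeff, sub_mul, Finset.sum_sub_distrib, mul_assoc, Finset.sum_mul,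
    ← Finset.mul_sum]
  rw [Finset.sum_comm]
  simp [Pi.single_apply]

/-- The functional averages differences of `g` between two vertices of the path `w, …, w + ℓ`, each
at most the total variation of `g` along it. This identifies the path resistance as an admissible
`R`. -/
lemma sq_sum_boxCoeff_mul_le {ℓ i : ℕ} (hℓ : 0 < ℓ) (hℓN : ℓ ≤ N) (hi : i ≤ ℓ) (w : ZMod N)
    (g : ZMod N → ℝ) :
    (∑ y, boxCoeff ℓ (w + (i : ZMod N)) w y * g y) ^ 2 ≤ pathResistance N b β w ℓ * dirichlet N b β g := by
  have hℓ' : (0 : ℝ) < ℓ := by exact_mod_cast hℓ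
  refine le_trans ?_ (sq_sum_abs_le w hℓN g)
  rw [sq_le_sq, sum_boxCoeff_mul]
  set D := ∑ l ∈ Finset.range ℓ, |g (w + l + 1) - g (w + l)| with hD
  have h1 : g (w + i) - 1 / (ℓ : ℝ) * ∑ j ∈ Finset.Icc 1 ℓ, g (w + (j : ZMod N)) =
      1 / (ℓ : ℝ) * ∑ j ∈ Finset.Icc 1 ℓ, (g (w + i) - g (w + (j : ZMod N))) := by
    rw [Finset.sum_sub_distrib, Finset.sum_const, Nat.card_Icc, nsmul_eq_mul]
    simp only [Nat.add_sub_cancel]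
    field_simp
  rw [h1, abs_mul, abs_of_pos (by positivity)]
  have h2 : |∑ j ∈ Finset.Icc 1 ℓ, (g (w + i) - g (w + (j : ZMod N)))| ≤ ℓ * D := by
    refine (Finset.abs_sum_le_sum_abs _ _).trans ?_
    refine (Finset.sum_le_card_nsmul _ _ D fun j hj =>
      abs_sub_le_sum_abs g hi (Finset.mem_Icc.1 hj).2).trans_eq ?_
    simp
  calc _ ≤ 1 / (ℓ : ℝ) * (ℓ * D) := by gcongr
    _ = D := by field_simp
    _ ≤ |D| := le_abs_self D

/-! ### Slow bonds -/

lemma IsLeftVertex.exists_eq {u : UnitAddCircle} {x : ZMod N} (h : IsLeftVertex N u x) :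
    ∃ θ ∈ Set.Ioc (0 : ℝ) 1, u = ZMod.toAddCircle x + ((θ / N : ℝ) : UnitAddCircle) := by
  have hN : (0 : ℝ) < N := by exact_mod_cast NeZero.pos N
  obtain ⟨v, ⟨h1, h2⟩, rfl⟩ := h
  rw [div_lt_iff₀ hN] at h1
  rw [le_div_iff₀ hN] at h2
  refine ⟨v * N - x.val, ⟨by linarith, by linarith⟩, ?_⟩
  rw [ZMod.toAddCircle_apply, ← AddCircle.coe_add]
  congr 1
  field_simp
  ring

/-- Both real representatives of `u` lie in `(0, 1]`, hence agree, and the intervals `(x/N,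
(x+1)/N]` are disjoint. -/
lemma IsLeftVertex.unique {u : UnitAddCircle} {x y : ZMod N} (hx : IsLeftVertex N u x)
    (hy : IsLeftVertex N u y) : x = y := by
  have hN : (0 : ℝ) < N := by exact_mod_cast NeZero.pos N
  obtain ⟨v, ⟨h1, h2⟩, rfl⟩ := hx
  obtain ⟨v', ⟨h1', h2'⟩, he⟩ := hy
  have hmem : ∀ (x : ZMod N) (v : ℝ), (x.val : ℝ) / N < v → v ≤ ((x.val : ℝ) + 1) / N →
      v ∈ Set.Ioc (0 : ℝ) (0 + 1) := by
    intro x v h1 h2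
    have h3 : (x.val : ℝ) + 1 ≤ N := by exact_mod_cast ZMod.val_lt x
    exact ⟨lt_of_le_of_lt (by positivity) h1, h2.trans (by rw [zero_add]; exact (div_le_one hN).2 h3)⟩
  have hv : v' = v := by
    have h0 := hmem x v h1 h2
    have h0' := hmem y v' h1' h2'
    rcases le_total v v' with h | h
    · exact (AddCircle.coe_eq_coe_iff_of_mem_Ico (a := v) ⟨h, by linarith [h0.1, h0'.2]⟩
        ⟨le_rfl, by linarith⟩).1 he
    · exact (AddCircle.coe_eq_coe_iff_of_mem_Ico (a := v') ⟨le_rfl, by linarith⟩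
        ⟨h, by linarith [h0'.1, h0.2]⟩).1 he
  subst hv
  rw [div_lt_iff₀ hN] at h1 h1'
  rw [le_div_iff₀ hN] at h2 h2'
  apply ZMod.val_injective
  have h3 : (x.val : ℝ) < y.val + 1 := by linarith
  have h4 : (y.val : ℝ) < x.val + 1 := by linarith
  have h5 : x.val < y.val + 1 := by exact_mod_cast h3
  have h6 : y.val < x.val + 1 := by exact_mod_cast h4
  omega

/-- Each point `b i` contributes at most one slow bond to the resistance of a path. -/
lemma pathResistance_le (w : ZMod N) {ℓ : ℕ} (hℓ : ℓ ≤ N) :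
    pathResistance N b β w ℓ ≤ ℓ + k * (N : ℝ) ^ β := by
  classical
  have hN : (0 : ℝ) ≤ N := Nat.cast_nonneg N
  refine (Finset.sum_le_sum fun l _ => inv_conductance_le _).trans ?_
  rw [Finset.sum_add_distrib, Finset.sum_comm]
  have h1 : ∀ i : Fin k, ∑ l ∈ Finset.range ℓ,
      (if IsLeftVertex N (b i) (w + l) then (N : ℝ) ^ β else 0) ≤ (N : ℝ) ^ β := by
    intro i
    rw [← Finset.sum_filter, Finset.sum_const, nsmul_eq_mul]
    refine mul_le_of_le_one_left (by positivity) ?_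
    rw [Nat.cast_le_one, Finset.card_le_one]
    intro l hl l' hl'
    rw [Finset.mem_filter, Finset.mem_range] at hl hl'
    exact injOn_add_natCast w (hl.1.trans_le hℓ) (hl'.1.trans_le hℓ) (hl.2.unique hl'.2)
  have h2 := Finset.sum_le_sum fun i (_ : i ∈ Finset.univ) => h1 i
  simp only [Finset.sum_const, Finset.card_univ, Fintype.card_fin, nsmul_eq_mul,
    Finset.card_range, mul_one] at h2 ⊢
  linarith

variable (b) in
/-- Distinct points among the `b i` are at distance at least some `δ > 0`. -/
lemma exists_separation : ∃ δ > 0, ∀ i j, b i ≠ b j → δ ≤ ‖b j - b i‖ := by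
  classical
  have h : ∀ p : Fin k × Fin k, ∃ δ > 0, b p.1 ≠ b p.2 → δ ≤ ‖b p.2 - b p.1‖ := by
    intro p
    by_cases hp : b p.1 = b p.2
    · exact ⟨1, one_pos, fun h => absurd hp h⟩
    · exact ⟨‖b p.2 - b p.1‖, norm_pos_iff.2 (sub_ne_zero.2 (Ne.symm hp)), fun _ => le_rfl⟩
  choose d hd hd2 using h
  obtain ⟨δ, hδ, hδ2⟩ : ∃ δ > 0, ∀ p, δ ≤ d p := by
    rcases isEmpty_or_nonempty (Fin k × Fin k) with he | hne
    · exact ⟨1, one_pos, fun p => (he.false p).elim⟩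
    · obtain ⟨p, hp⟩ := Finite.exists_min d
      exact ⟨d p, hd p, hp⟩
  exact ⟨δ, hδ, fun i j hij => (hδ2 (i, j)).trans (hd2 (i, j) hij)⟩

/-- Two different slow bonds are macroscopically far apart. -/
lemma not_isSlowBond_of_separated {δ : ℝ} (hδ : ∀ i j, b i ≠ b j → δ ≤ ‖b j - b i‖)
    {ℓ l : ℕ} (hl : l < ℓ) (hℓN : ℓ < N) (hℓδ : ((ℓ : ℝ) + 1) / N < δ) {w : ZMod N}
    (hz : IsSlowBond N b (w + (ℓ : ZMod N))) : ¬ IsSlowBond N b (w + (l : ZMod N)) := by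
  have hN : (0 : ℝ) < N := by exact_mod_cast NeZero.pos N
  rintro ⟨i, hi⟩
  obtain ⟨j, hj⟩ := hz
  by_cases hij : b i = b j
  · rw [hij] at hi
    exact hl.ne (injOn_add_natCast w (hl.trans hℓN) hℓN (hi.unique hj))
  · refine (hδ i j hij).not_gt (lt_of_le_of_lt ?_ hℓδ)
    obtain ⟨θ, hθ, h1⟩ := hi.exists_eq
    obtain ⟨θ', hθ', h2⟩ := hj.exists_eq
    have h3 : ∀ m : ℕ, ZMod.toAddCircle (m : ZMod N) = (((m : ℝ) / N : ℝ) : UnitAddCircle) := by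
      intro m
      have := ZMod.toAddCircle_intCast (N := N) (m : ℤ)
      simpa using this
    -- The offsets θ, θ' within the two bonds lie in `(0, 1]`, so the points are within `(ℓ + 1)/N`
    -- of each other.
    have h4 : b j - b i = (((ℓ : ℝ) / N + θ' / N - l / N - θ / N : ℝ) : UnitAddCircle) := by
      rw [h1, h2, map_add, map_add, h3, h3]
      rw [AddCircle.coe_sub, AddCircle.coe_sub, AddCircle.coe_add]
      abel
    have h5 : ((l : ℝ) + 1) ≤ ℓ := by exact_mod_cast hl
    have h6 : (0 : ℝ) ≤ l := Nat.cast_nonneg l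
    rw [h4]
    refine (QuotientAddGroup.norm_mk_le_norm).trans ?_
    rw [Real.norm_eq_abs, show (ℓ : ℝ) / N + θ' / N - l / N - θ / N = (ℓ + θ' - l - θ) / N by ring,
      abs_div, abs_of_pos hN]
    gcongr
    rw [abs_le]
    constructor <;> linarith [hθ.1, hθ.2, hθ'.1, hθ'.2]

/-- The box of the empirical density at `x` is connected to `x` by a path without slow bonds
when `β ≥ 1`. -/
lemma exists_box_of_one_le (hβ : 1 ≤ β) {δ : ℝ} (hδ : ∀ i j, b i ≠ b j → δ ≤ ‖b j - b i‖)
    {ℓ : ℕ} (hℓN : ℓ < N) (hℓδ : ((ℓ : ℝ) + 1) / N < δ) (x : ZMod N) :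
    ∃ (w : ZMod N) (i : ℕ), i ≤ ℓ ∧ x = w + i ∧ pathResistance N b β w ℓ = ℓ ∧
      ∀ η, empiricalDensity b β ℓ η x = boxMean ℓ η w := by
  have hβ' : ¬ β < 1 := not_lt.2 hβ
  by_cases h : ∃ j : ℕ, j ≤ ℓ ∧ IsSlowBond N b (x + (j : ZMod N))
  · set m := sInf {j : ℕ | IsSlowBond N b (x + (j : ZMod N))} with hm
    obtain ⟨j, hj, hjs⟩ := h
    have hms : IsSlowBond N b (x + (m : ZMod N)) :=
      Nat.sInf_mem (s := {j : ℕ | IsSlowBond N b (x + (j : ZMod N))}) ⟨j, hjs⟩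
    have hmℓ : m ≤ ℓ := (Nat.sInf_le (s := {j : ℕ | IsSlowBond N b (x + (j : ZMod N))}) hjs).trans hj
    -- With z = x + m the left vertex of the slow bond, the path runs from z − ℓ to z: it passes
    -- through x and stops just before the bond {z, z+1}.
    refine ⟨x + (m : ZMod N) - (ℓ : ZMod N), ℓ - m, Nat.sub_le _ _, ?_, ?_, fun η => ?_⟩
    · rw [Nat.cast_sub hmℓ]; ring
    · refine pathResistance_of_not_isSlowBond fun l hl => ?_
      exact not_isSlowBond_of_separated hδ hl hℓN hℓδ (by rwa [sub_add_cancel])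
    · rw [empiricalDensity, if_neg hβ', if_pos ⟨j, hj, hjs⟩]
  · refine ⟨x, 0, Nat.zero_le _, by simp, ?_, fun η => ?_⟩
    · refine pathResistance_of_not_isSlowBond fun l hl hs => h ⟨l, hl.le, hs⟩
    · rw [empiricalDensity, if_neg hβ', if_neg h]

end Resistance

/-! ### Passage to the limit in N and ε -/

section Main

variable {k : ℕ} {b : Fin k → UnitAddCircle} {β : ℝ}

/-- The replacement estimate for a fixed box `w + 1, …, w + ℓ`. -/
lemma IsExclusionLaw.lintegral_discrepancy_le {N : ℕ} [NeZero N] {μ : Measure (Config N)}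
    {P : Measure (PathSpace N)} (hP : IsExclusionLaw N b β μ P) {ε t : ℝ} (ht : 0 ≤ t)
    (hℓ : 0 < ⌊ε * (N : ℝ)⌋₊) (hℓN : ⌊ε * (N : ℝ)⌋₊ ≤ N) {x w : ZMod N} {i : ℕ}
    (hi : i ≤ ⌊ε * (N : ℝ)⌋₊) (hx : x = w + i)
    (hR : pathResistance N b β w ⌊ε * (N : ℝ)⌋₊ ≤ 2 * ε * N)
    (hbox : ∀ η : Config N, empiricalDensity b β ⌊ε * (N : ℝ)⌋₊ η x =
      boxMean ⌊ε * (N : ℝ)⌋₊ η w) :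
    ∫⁻ ω, ENNReal.ofReal |∫ s in (0 : ℝ)..t, discrepancy b β ε ω s x| ∂P ≤
      ENNReal.ofReal √(2 * t * √(ε * t)) := by
  have hN : (0 : ℝ) < N := by exact_mod_cast NeZero.pos N
  subst hx
  have h := hP.lintegral_abs_integral_le (pathResistance_nonneg w ⌊ε * (N : ℝ)⌋₊)
    (fun g => sq_sum_boxCoeff_mul_le hℓ hℓN hi w g)
    (V := fun η => occ η (w + i) - boxMean ⌊ε * (N : ℝ)⌋₊ η w)
    (fun η => by rw [sum_boxCoeff_mul]; rfl)
    (fun η => abs_occ_sub_boxMean_le_one _ η _ _) ht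
  simp only [discrepancy, hbox]
  refine h.trans (ENNReal.ofReal_le_ofReal ?_)
  have h2 : pathResistance N b β w ⌊ε * (N : ℝ)⌋₊ / (2 * N) ≤ ε := by
    rw [div_le_iff₀ (by positivity)]
    linarith
  gcongr

variable (b) in
/-- The replacement estimate, uniformly in the site. -/
lemma eventually_lintegral_discrepancy_le (β : ℝ) :
    ∀ᶠ ε : ℝ in 𝓝[>] 0, ∀ᶠ N : ℕ+ in atTop, ∀ (μ : Measure (Config N))
      (P : Measure (PathSpace N)), IsExclusionLaw N b β μ P → ∀ t : ℝ, 0 ≤ t → ∀ x : ZMod N,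
      ∫⁻ ω, ENNReal.ofReal |∫ s in (0 : ℝ)..t, discrepancy b β ε ω s x| ∂P ≤
        ENNReal.ofReal √(2 * t * √(ε * t)) := by
  obtain ⟨δ, hδ0, hδ⟩ := exists_separation b
  have hsmall : ∀ᶠ ε : ℝ in 𝓝[>] 0, ε < min 1 δ :=
    nhdsWithin_le_nhds (Iio_mem_nhds (lt_min one_pos hδ0))
  filter_upwards [hsmall, self_mem_nhdsWithin] with ε hε hε0
  rw [Set.mem_Ioi] at hε0
  have hε1 : ε < 1 := hε.trans_le (min_le_left _ _)
  have hεδ : ε < δ := hε.trans_le (min_le_right _ _)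
  have hcast : Tendsto (fun N : ℕ+ => ((N : ℕ) : ℝ)) atTop atTop :=
    tendsto_natCast_atTop_atTop.comp tendsto_PNat_val_atTop_atTop
  -- `h1` makes the box nonempty; `h2` gives εN + 1 < δN, so that a box is shorter than the gap
  -- between distinct slow bonds.
  have h1 : ∀ᶠ N : ℕ+ in atTop, 1 / ε ≤ ((N : ℕ) : ℝ) := hcast.eventually_ge_atTop _
  have h2 : ∀ᶠ N : ℕ+ in atTop, 1 / (δ - ε) < ((N : ℕ) : ℝ) := hcast.eventually_gt_atTop _
  -- For β < 1 all slow bonds together add resistance o(N), which accounts for the second εN in the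
  -- bound 2εN.
  have h3 : β < 1 → ∀ᶠ N : ℕ+ in atTop, (k : ℝ) * ((N : ℕ) : ℝ) ^ β ≤ ε * ((N : ℕ) : ℝ) := by
    intro hβ1
    have h4 := ((tendsto_rpow_neg_atTop (sub_pos.2 hβ1)).comp hcast).const_mul (k : ℝ)
    rw [mul_zero] at h4
    filter_upwards [h4.eventually_le_const hε0] with N hN
    have hpos : (0 : ℝ) < ((N : ℕ) : ℝ) := by exact_mod_cast N.pos
    simp only [Function.comp_apply, neg_sub] at hN
    rw [Real.rpow_sub_one hpos.ne', ← mul_div_assoc, div_le_iff₀ hpos] at hN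
    exact hN
  have h5 : ∀ᶠ N : ℕ+ in atTop, β < 1 →
      (k : ℝ) * ((N : ℕ) : ℝ) ^ β ≤ ε * ((N : ℕ) : ℝ) := by
    by_cases hβ1 : β < 1
    · filter_upwards [h3 hβ1] with N hN _ using hN
    · exact Eventually.of_forall fun N h => absurd h hβ1
  filter_upwards [h1, h2, h5] with N h1 h2 h5 μ P hP t ht x
  have hN : (0 : ℝ) < ((N : ℕ) : ℝ) := by exact_mod_cast N.pos
  have hfl : (⌊ε * ((N : ℕ) : ℝ)⌋₊ : ℝ) ≤ ε * ((N : ℕ) : ℝ) := Nat.floor_le (by positivity)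
  have hℓ : 0 < ⌊ε * ((N : ℕ) : ℝ)⌋₊ := by
    rw [Nat.floor_pos]
    rw [div_le_iff₀ hε0] at h1
    linarith
  have hℓN : ⌊ε * ((N : ℕ) : ℝ)⌋₊ < N := by
    have : (⌊ε * ((N : ℕ) : ℝ)⌋₊ : ℝ) < ((N : ℕ) : ℝ) := by nlinarith
    exact_mod_cast this
  rcases lt_or_ge β 1 with hβ1 | hβ1
  · refine hP.lintegral_discrepancy_le ht hℓ hℓN.le (i := 0) (w := x) (Nat.zero_le _) (by simp) ?_
      fun η => by rw [empiricalDensity, if_pos hβ1]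
    refine (pathResistance_le x hℓN.le).trans ?_
    linarith [h5 hβ1]
  · have hδℓ : ((⌊ε * ((N : ℕ) : ℝ)⌋₊ : ℝ) + 1) / ((N : ℕ) : ℝ) < δ := by
      rw [div_lt_iff₀ (sub_pos.2 hεδ)] at h2
      rw [div_lt_iff₀ hN]
      linarith
    obtain ⟨w, i, hi, hx, hR, hbox⟩ := exists_box_of_one_le hβ1 hδ hℓN hδℓ x
    refine hP.lintegral_discrepancy_le ht hℓ hℓN.le hi hx ?_ hbox
    rw [hR]
    have : 0 < ε * ((N : ℕ) : ℝ) := by positivity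
    linarith

lemma limsup_limsup_eq_zero {F : ℝ → ℕ+ → ℝ≥0∞} {t : ℝ} {C : ℝ≥0∞} (hC : C ≠ ⊤)
    (h : ∀ᶠ ε : ℝ in 𝓝[>] 0, ∀ᶠ N : ℕ+ in atTop,
      F ε N ≤ C * ENNReal.ofReal √(2 * t * √(ε * t))) :
    limsup (fun ε : ℝ => limsup (fun N : ℕ+ => F ε N) atTop) (𝓝[>] 0) = 0 := by
  have h1 : Tendsto (fun ε : ℝ => C * ENNReal.ofReal √(2 * t * √(ε * t))) (𝓝[>] 0) (𝓝 0) := by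
    have h2 : Continuous fun ε : ℝ => √(2 * t * √(ε * t)) := by fun_prop
    have h3 := ENNReal.Tendsto.const_mul (a := C)
      (ENNReal.tendsto_ofReal ((h2.tendsto 0).mono_left (nhdsWithin_le_nhds (s := Set.Ioi 0)))) (Or.inr hC)
    simpa using h3
  refine le_antisymm ?_ zero_le
  rw [← h1.limsup_eq]
  refine limsup_le_limsup ?_
  filter_upwards [h] with ε hε
  exact limsup_le_of_le (h := hε)

lemma abs_occ_sub_empiricalDensity_le_one {N : ℕ} [NeZero N] (ℓ : ℕ) (η : Config N) (x : ZMod N) :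
    |occ η x - empiricalDensity b β ℓ η x| ≤ 1 := by
  unfold empiricalDensity
  split_ifs <;> exact abs_occ_sub_boxMean_le_one ℓ η x _

lemma intervalIntegrable_discrepancy {N : ℕ} [NeZero N] (ε t : ℝ) (ω : PathSpace N)
    (x : ZMod N) : IntervalIntegrable (fun s => discrepancy b β ε ω s x) volume 0 t := by
  have hm : Measurable fun s : ℝ => discrepancy b β ε ω s x :=
    (measurable_comp_path (N := N) fun η =>
      occ η x - empiricalDensity b β ⌊ε * (N : ℝ)⌋₊ η x).comp measurable_prodMk_right
  refine (intervalIntegrable_const (c := (1 : ℝ))).mono_fun hm.aestronglyMeasurable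
    (Eventually.of_forall fun s => ?_)
  rw [norm_one]
  exact abs_occ_sub_empiricalDensity_le_one _ (ω.1 s.toNNReal) x

lemma measurable_abs_integral_discrepancy {N : ℕ} [NeZero N] (ε : ℝ) {t : ℝ} (ht : 0 ≤ t)
    (x : ZMod N) : Measurable fun ω : PathSpace N =>
      ENNReal.ofReal |∫ s in (0 : ℝ)..t, discrepancy b β ε ω s x| := by
  have hm : StronglyMeasurable fun ω : PathSpace N =>
      ∫ s, discrepancy b β ε ω s x ∂(volume.restrict (Set.Ioc 0 t)) :=
    ((measurable_comp_path (N := N) fun η =>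
      occ η x - empiricalDensity b β ⌊ε * (N : ℝ)⌋₊ η x).comp
        measurable_swap).stronglyMeasurable.integral_prod_right'
  simp only [intervalIntegral.integral_of_le ht]
  exact hm.measurable.abs.ennreal_ofReal

/-- A uniform estimate for the sites controls weighted averages over all sites. -/
lemma lintegral_weighted_discrepancy_le {N : ℕ} [NeZero N] (P : Measure (PathSpace N))
    {ε t : ℝ} (ht : 0 ≤ t) (h : ZMod N → ℝ) {B : ℝ≥0∞}
    (hB : ∀ x : ZMod N,
      ∫⁻ ω, ENNReal.ofReal |∫ s in (0 : ℝ)..t, discrepancy b β ε ω s x| ∂P ≤ B) :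
    ∫⁻ ω, ENNReal.ofReal |∫ s in (0 : ℝ)..t,
        (1 / (N : ℝ)) * ∑ x : ZMod N, h x * discrepancy b β ε ω s x| ∂P ≤
      (1 + ENNReal.ofReal ((1 / (N : ℝ)) * ∑ x : ZMod N, h x ^ 2)) * B := by
  have hN : (0 : ℝ) < N := by exact_mod_cast NeZero.pos N
  have h1 : ∀ ω : PathSpace N, ENNReal.ofReal |∫ s in (0 : ℝ)..t,
        (1 / (N : ℝ)) * ∑ x : ZMod N, h x * discrepancy b β ε ω s x| ≤
      ∑ x : ZMod N, ENNReal.ofReal (1 / (N : ℝ) * |h x|) *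
        ENNReal.ofReal |∫ s in (0 : ℝ)..t, discrepancy b β ε ω s x| := by
    intro ω
    simp only [← ENNReal.ofReal_mul (show 0 ≤ 1 / (N : ℝ) * |h _| by positivity)]
    rw [← ENNReal.ofReal_sum_of_nonneg fun x _ => by positivity]
    refine ENNReal.ofReal_le_ofReal ?_
    rw [intervalIntegral.integral_const_mul, intervalIntegral.integral_finsetSum fun x _ =>
      (intervalIntegrable_discrepancy ε t ω x).const_mul _, abs_mul,
      abs_of_pos (show 0 < 1 / (N : ℝ) by positivity)]
    simp only [intervalIntegral.integral_const_mul, mul_assoc, ← Finset.mul_sum, ← abs_mul]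
    gcongr
    exact Finset.abs_sum_le_sum_abs _ _
  calc _ ≤ ∫⁻ ω, ∑ x : ZMod N, ENNReal.ofReal (1 / (N : ℝ) * |h x|) *
        ENNReal.ofReal |∫ s in (0 : ℝ)..t, discrepancy b β ε ω s x| ∂P := lintegral_mono h1
    _ = ∑ x : ZMod N, ENNReal.ofReal (1 / (N : ℝ) * |h x|) *
        ∫⁻ ω, ENNReal.ofReal |∫ s in (0 : ℝ)..t, discrepancy b β ε ω s x| ∂P := by
      rw [lintegral_finsetSum _ fun x _ =>
        (measurable_abs_integral_discrepancy ε ht x).const_mul _]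
      refine Finset.sum_congr rfl fun x _ => ?_
      rw [lintegral_const_mul _ (measurable_abs_integral_discrepancy ε ht x)]
    _ ≤ ∑ x : ZMod N, ENNReal.ofReal (1 / (N : ℝ) * |h x|) * B := by gcongr; exact hB _
    _ = ENNReal.ofReal (∑ x : ZMod N, 1 / (N : ℝ) * |h x|) * B := by
      rw [← Finset.sum_mul, ENNReal.ofReal_sum_of_nonneg fun x _ => by positivity]
    _ ≤ ENNReal.ofReal (1 + (1 / (N : ℝ)) * ∑ x : ZMod N, h x ^ 2) * B := by
      gcongr
      rw [Finset.mul_sum]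
      calc _ ≤ ∑ x : ZMod N, (1 / (N : ℝ) + 1 / (N : ℝ) * h x ^ 2) := by
            refine Finset.sum_le_sum fun x _ => ?_
            rw [← mul_one_add]
            gcongr
            -- |h| ≤ 1 + h², so the weights need only a bounded mean square.
            nlinarith [sq_nonneg (|h x| - 1), sq_abs (h x)]
        _ = _ := by
            rw [Finset.sum_add_distrib, Finset.sum_const, Finset.card_univ, ZMod.card,
              nsmul_eq_mul, mul_one_div_cancel hN.ne']
    _ = _ := by
      rw [ENNReal.ofReal_add zero_le_one (by positivity), ENNReal.ofReal_one]

end Main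

end SlowBond

end

theorem mainTheorem2 {k : ℕ} (b : Fin k → UnitAddCircle) (β : ℝ) (hβ : 0 ≤ β)
    (μ : ∀ N : ℕ+, Measure (SlowBond.Config N)) (hμ : ∀ N, IsProbabilityMeasure (μ N))
    (P : ∀ N : ℕ+, Measure (SlowBond.PathSpace N))
    (hP : ∀ N : ℕ+, SlowBond.IsExclusionLaw N b β (μ N) (P N))
    (t : ℝ) (ht : 0 ≤ t) :
    (β < 1 → ∀ (u : UnitAddCircle) (x : ∀ N : ℕ+, ZMod N),
      (∀ N : ℕ+, SlowBond.IsLeftVertex N u (x N) ∨ SlowBond.IsLeftVertex N u (x N - 1)) →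
      limsup (fun ε : ℝ => limsup (fun N : ℕ+ =>
        ∫⁻ ω, ENNReal.ofReal |∫ s in (0 : ℝ)..t, SlowBond.discrepancy b β ε ω s (x N)| ∂(P N))
        atTop) (𝓝[>] 0) = 0) ∧
    (1 ≤ β →
      (∀ x : ∀ N : ℕ+, ZMod N,
        limsup (fun ε : ℝ => limsup (fun N : ℕ+ =>
          ∫⁻ ω, ENNReal.ofReal |∫ s in (0 : ℝ)..t, SlowBond.discrepancy b β ε ω s (x N)| ∂(P N))
          atTop) (𝓝[>] 0) = 0) ∧
      (∀ H : UnitAddCircle → ℝ,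
        limsup (fun N : ℕ+ => ENNReal.ofReal
          ((1 / (N : ℝ)) * ∑ x : ZMod N, (H (SlowBond.macro_point N x)) ^ 2)) atTop < ⊤ →
        limsup (fun ε : ℝ => limsup (fun N : ℕ+ =>
          ∫⁻ ω, ENNReal.ofReal |∫ s in (0 : ℝ)..t,
            (1 / (N : ℝ)) * ∑ x : ZMod N, H (SlowBond.macro_point N x) *
              SlowBond.discrepancy b β ε ω s x| ∂(P N))
          atTop) (𝓝[>] 0) = 0)) := by
  have key := SlowBond.eventually_lintegral_discrepancy_le b β
  have hsite : ∀ x : ∀ N : ℕ+, ZMod N,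
      limsup (fun ε : ℝ => limsup (fun N : ℕ+ =>
        ∫⁻ ω, ENNReal.ofReal |∫ s in (0 : ℝ)..t, SlowBond.discrepancy b β ε ω s (x N)| ∂(P N))
        atTop) (𝓝[>] 0) = 0 := by
    intro x
    refine SlowBond.limsup_limsup_eq_zero (t := t) (C := 1) ENNReal.one_ne_top ?_
    filter_upwards [key] with ε hε
    filter_upwards [hε] with N hN
    rw [one_mul]
    exact hN (μ N) (P N) (hP N) t ht (x N)
  refine ⟨fun _ _ x _ => hsite x, fun _ => ⟨hsite, fun H hH => ?_⟩⟩
  -- A finite `C` strictly above the limsup bounds the mean squares of `H` for all large `N`,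
  -- independently of ε.
  obtain ⟨C, hC1, hC2⟩ := exists_between hH
  refine SlowBond.limsup_limsup_eq_zero (t := t) (C := 1 + C)
    (ENNReal.add_ne_top.2 ⟨ENNReal.one_ne_top, hC2.ne⟩) ?_
  filter_upwards [key] with ε hε
  filter_upwards [hε, eventually_lt_of_limsup_lt hC1] with N hN hHN
  refine (SlowBond.lintegral_weighted_discrepancy_le (P N) ht
    (fun x => H (SlowBond.macro_point N x)) (hN (μ N) (P N) (hP N) t ht)).trans ?_
  gcongr
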